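/- Consider a network of $n$ parties $\mathsf{A}_1,\dots,\mathsf{A}_n$ which share finitely many independent copies of the EPR state $\frac{1}{\sqrt2}(|00\rangle+|11\rangle)$, the GHZ state $\frac{1}{\sqrt2}(|000\rangle+|111\rangle)$ and the W state $\frac{1}{\sqrt3}(|100\rangle+|010\rangle+|001\rangle)$. The two qubits of each EPR state are held by two different parties, the three qubits of each GHZ state are held by two or three different parties, and the three qubits of each W state are held by three different parties. The total state $\rho_{\mathsf{A}_1\cdots\mathsf{A}_n}$ is the tensor product of all these pure states, and the system of party $\mathsf{A}_i$ consists of all the qubits that it holds. For $i\neq j$ let $k_{ij}$ be the number of two-party GHZ marginals shared by $\mathsf{A}_i$ and $\mathsf{A}_j$, that is, of GHZ states held by three different parties including $\mathsf{A}_i$ and $\mathsf{A}_j$, and let $l_{ij}$ be the number of two-party W marginals which they share, that is, of W states of which both hold a qubit. Suppose that $l_{ij}\le 5k_{ij}$ for all $i\ne j$. Then for every $i$ $$\mathcal{E}_{\mathsf{A}_i|\overline{\mathsf{A}_i}}(\rho_{\mathsf{A}_1\cdots\mathsf{A}_n})\ \ge\ \sum_{j\neq i}\mathcal{E}_{\mathsf{A}_i|\mathsf{A}_j}(\rho_{\mathsf{A}_i\mathsf{A}_j}).$$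 Here $\overline{\mathsf{A}_i}$ denotes all the parties except $\mathsf{A}_i$, $\rho_{\mathsf{A}_i\mathsf{A}_j}$ is the reduced state of $\mathsf{A}_i$ and $\mathsf{A}_j$, and $\mathcal{E}_{\mathsf{X}|\mathsf{Y}}$ is the entanglement of formation: $\mathcal{E}_{\mathsf X|\mathsf Y}(|\phi\rangle)=-\mathrm{Tr}(\rho_{\mathsf X}\log_2\rho_{\mathsf X})$ with $\rho_{\mathsf X}=\mathrm{Tr}_{\mathsf Y}|\phi\rangle\langle\phi|$ for a pure state, and $\mathcal{E}_{\mathsf X|\mathsf Y}(\rho)=\inf\sum_m p_m\mathcal{E}_{\mathsf X|\mathsf Y}(|\phi_m\rangle)$ for a mixed state, where the infimum is over all finite decompositions $\rho=\sum_m p_m|\phi_m\rangle\langle\phi_m|$ into normalized pure states with $p_m\ge0$ and $\sum_m p_m=1$. -/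

import Mathlib

noncomputable section

/-- Von Neumann entropy in bits, `-∑ λ log₂ λ` over the eigenvalues (with multiplicity) of a
Hermitian matrix, that is `-Tr (ρ log₂ ρ)`. -/
def vonNeumannEntropy {α : Type*} [Fintype α] [DecidableEq α] (ρ : Matrix α α ℂ)
    (hρ : ρ.IsHermitian) : ℝ :=
  -∑ k, hρ.eigenvalues k * Real.logb 2 (hρ.eigenvalues k)

/-- The density matrix `|φ⟩⟨φ|` of a ket given by its coordinates in the standard basis. -/
def ketbra {α : Type*} (φ : α → ℂ) : Matrix α α ℂ :=
  Matrix.vecMulVec φ (star φ)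

/-- The reduced matrix `Tr_B |φ⟩⟨φ|` of a ket of a bipartite system whose two factors have
standard bases indexed by `α` and `β`. -/
def reducedLeft {α β : Type*} [Fintype β] (φ : α × β → ℂ) : Matrix α α ℂ :=
  Matrix.of fun a a' => ∑ b, ketbra φ (a, b) (a', b)

theorem reducedLeft_isHermitian {α β : Type*} [Fintype β] (φ : α × β → ℂ) :
    (reducedLeft φ).IsHermitian := by
  ext a a'
  simp [reducedLeft, ketbra, Matrix.vecMulVec_apply, mul_comm]

/-- Entanglement of formation of a bipartite pure state: the entropy of its first marginal. -/
def eofPure {α β : Type*} [Fintype α] [DecidableEq α] [Fintype β] (φ : α × β → ℂ) : ℝ :=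
  vonNeumannEntropy (reducedLeft φ) (reducedLeft_isHermitian φ)

/-- Entanglement of formation of a bipartite density matrix: the infimum of the average
entanglement over all decompositions into pure states. -/
def eof {α β : Type*} [Fintype α] [DecidableEq α] [Fintype β]
    (ρ : Matrix (α × β) (α × β) ℂ) : ℝ :=
  sInf {E : ℝ | ∃ (m : ℕ) (p : Fin m → ℝ) (φ : Fin m → α × β → ℂ),
    (∀ k, 0 ≤ p k) ∧ ∑ k, p k = 1 ∧ (∀ k, ∑ x, ‖φ k x‖ ^ 2 = 1) ∧
    ρ = ∑ k, (p k : ℂ) • ketbra (φ k) ∧ E = ∑ k, p k * eofPure (φ k)}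

/-- The standard basis of a system of qubits labelled by `Q` is indexed by bit strings. -/
abbrev Bits (Q : Type*) : Type _ := Q → Fin 2

/-- The reduced density matrix of the qubits satisfying `S`: the partial trace over all the
other qubits. -/
def reduceTo {Q : Type*} [Fintype Q] [DecidableEq Q] (S : Q → Prop) [DecidablePred S]
    (ρ : Matrix (Bits Q) (Bits Q) ℂ) :
    Matrix (Bits {q // S q}) (Bits {q // S q}) ℂ :=
  Matrix.of fun a a' => ∑ z : {q // ¬ S q} → Fin 2,
    ρ ((Equiv.piEquivPiSubtypeProd S fun _ => Fin 2).symm (a, z))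
      ((Equiv.piEquivPiSubtypeProd S fun _ => Fin 2).symm (a', z))

/-- Entanglement of formation of a state of qubits with respect to the bipartite cut between
the qubits satisfying `S` and all the other ones. -/
def eofCut {Q : Type*} [Fintype Q] [DecidableEq Q] (S : Q → Prop) [DecidablePred S]
    (ρ : Matrix (Bits Q) (Bits Q) ℂ) : ℝ :=
  eof (Matrix.reindex (Equiv.piEquivPiSubtypeProd S fun _ => Fin 2)
    (Equiv.piEquivPiSubtypeProd S fun _ => Fin 2) ρ)

/-- The EPR state `(|00⟩ + |11⟩) / √2`. -/
def eprKet (x : Bits (Fin 2)) : ℂ :=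
  if x = ![0, 0] ∨ x = ![1, 1] then ((1 / Real.sqrt 2 : ℝ) : ℂ) else 0

/-- The GHZ state `(|000⟩ + |111⟩) / √2`. -/
def ghzKet (x : Bits (Fin 3)) : ℂ :=
  if x = ![0, 0, 0] ∨ x = ![1, 1, 1] then ((1 / Real.sqrt 2 : ℝ) : ℂ) else 0

/-- The W state `(|100⟩ + |010⟩ + |001⟩) / √3`. -/
def wKet (x : Bits (Fin 3)) : ℂ :=
  if x = ![1, 0, 0] ∨ x = ![0, 1, 0] ∨ x = ![0, 0, 1] then ((1 / Real.sqrt 3 : ℝ) : ℂ) else 0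

/-- A network of EPR, GHZ and W states with parties labelled by `Fin n`: finitely many copies
of each state, and for each qubit of each copy the party which holds it. An EPR state is shared
by two parties, a GHZ state by two or three parties, and a W state by three parties. -/
structure QuantumNetwork (n : ℕ) where
  numEPR : ℕ
  numGHZ : ℕ
  numW : ℕ
  epr : Fin numEPR → Fin 2 → Fin n
  ghz : Fin numGHZ → Fin 3 → Fin n
  w : Fin numW → Fin 3 → Fin n
  epr_injective : ∀ e, Function.Injective (epr e)
  ghz_shared : ∀ g, ∃ a b, ghz g a ≠ ghz g b
  w_injective : ∀ v, Function.Injective (w v)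

namespace QuantumNetwork

variable {n : ℕ} (N : QuantumNetwork n)

/-- All the qubits of the network. -/
abbrev Qubit : Type :=
  (Fin N.numEPR × Fin 2) ⊕ (Fin N.numGHZ × Fin 3) ⊕ (Fin N.numW × Fin 3)

/-- The party which holds a given qubit. -/
def owner : N.Qubit → Fin n
  | Sum.inl (e, a) => N.epr e a
  | Sum.inr (Sum.inl (g, a)) => N.ghz g a
  | Sum.inr (Sum.inr (v, a)) => N.w v a

/-- The tensor product of all the EPR, GHZ and W states of the network. -/
def ket (x : Bits N.Qubit) : ℂ :=
  (∏ e, eprKet fun a => x (Sum.inl (e, a))) *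
  (∏ g, ghzKet fun a => x (Sum.inr (Sum.inl (g, a)))) *
  ∏ v, wKet fun a => x (Sum.inr (Sum.inr (v, a)))

/-- The total state of the network. -/
def totalState : Matrix (Bits N.Qubit) (Bits N.Qubit) ℂ := ketbra N.ket

/-- The joint reduced state of parties `i` and `j`. -/
def pairState (i j : Fin n) :
    Matrix (Bits {q // N.owner q = i ∨ N.owner q = j})
      (Bits {q // N.owner q = i ∨ N.owner q = j}) ℂ :=
  reduceTo (fun q => N.owner q = i ∨ N.owner q = j) N.totalState

/-- Entanglement of formation between party `i` and all the other parties. -/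
def eofRest (i : Fin n) : ℝ :=
  eofCut (fun q => N.owner q = i) N.totalState

/-- Entanglement of formation between parties `i` and `j` in their joint reduced state. -/
def eofPair (i j : Fin n) : ℝ :=
  eofCut (fun q => N.owner q.1 = i) (N.pairState i j)

/-- The number of two-party GHZ marginals shared by `i` and `j`: the GHZ states held by three
different parties, two of which are `i` and `j`. -/
def ghzMarginals (i j : Fin n) : ℕ :=
  (Finset.univ.filter fun g =>
    Function.Injective (N.ghz g) ∧ (∃ a, N.ghz g a = i) ∧ ∃ b, N.ghz g b = j).card

/-- The number of two-party W marginals shared by `i` and `j`: the W states of which both `i`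
and `j` hold a qubit. -/
def wMarginals (i j : Fin n) : ℕ :=
  (Finset.univ.filter fun v => (∃ a, N.w v a = i) ∧ ∃ b, N.w v b = j).card

end QuantumNetwork

end

/-! Both sides are compared state by state. For a pure state the entanglement of formation is the
entropy of a marginal, which is additive on tensor products (`IsPartition.cutEntropy_tensorKet`), so
party `i` gains 1 from every EPR or GHZ state that it shares and h(1/3) from every W state
(`le_eofRest`), with h the binary entropy in bits.

A pair is bounded above by exhibiting one decomposition, the product of decompositions of the
components (`eofPair_le`). An EPR state, or a GHZ state held by two parties, contributes at most 1
and only for a single `j` (`sum_catPairBound_le`). A GHZ state held by three parties has separable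
marginals and contributes 0, leaving a surplus of 1 at `i`. A W marginal costs about 0.550, which is
below (h(1/3) + 1/5)/2 (`isMixtureBelow_wKet`, `binEntropy_div_log_le`); a W state at `i` has two
such marginals, so its deficit is at most 1/5.

Summing `l_ij ≤ 5 k_ij` over `j` counts each state at `i` twice on both sides. Hence `i` holds at
most five times as many W states as three-party GHZ states, and the surpluses cover the deficits. -/

noncomputable section

/-! ### Von Neumann entropy from spectra; Shannon entropy of product distributions. -/

section Entropy

open scoped ComplexOrder

variable {α : Type*} [Fintype α] [DecidableEq α]

/-- The entropy can be read off from any diagonalization by an isometry. -/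
theorem vonNeumannEntropy_eq_of_isometry {κ : Type*} [Fintype κ] [DecidableEq κ]
    {ρ : Matrix α α ℂ} (hρ : ρ.IsHermitian) (u : Matrix α κ ℂ) (d : κ → ℝ)
    (hu : u.conjTranspose * u = 1)
    (h : ρ = u * Matrix.diagonal (fun k => (d k : ℂ)) * u.conjTranspose) :
    vonNeumannEntropy ρ hρ = -∑ k, d k * Real.logb 2 (d k) := by
  -- AB and BA have the same characteristic polynomial up to powers of X. The extra roots are zeros,
  -- and these contribute 0 to the entropy.
  have key := Matrix.charpoly_mul_comm' (u * Matrix.diagonal (fun k => (d k : ℂ))) u.conjTranspose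
  rw [← Matrix.mul_assoc, hu, Matrix.one_mul, ← h, hρ.charpoly_eq, Matrix.charpoly_diagonal] at key
  have hroots := congrArg Polynomial.roots key
  rw [Polynomial.roots_mul, Polynomial.roots_mul, Polynomial.roots_pow, Polynomial.roots_pow,
    Polynomial.roots_prod, Polynomial.roots_prod, Polynomial.roots_X] at hroots
  rotate_left
  · simp [Finset.prod_ne_zero_iff, Polynomial.X_sub_C_ne_zero]
  · simp [Finset.prod_ne_zero_iff, Polynomial.X_sub_C_ne_zero]
  · exact mul_ne_zero (pow_ne_zero _ Polynomial.X_ne_zero)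
      (by simp [Finset.prod_ne_zero_iff, Polynomial.X_sub_C_ne_zero])
  · exact mul_ne_zero (pow_ne_zero _ Polynomial.X_ne_zero)
      (by simp [Finset.prod_ne_zero_iff, Polynomial.X_sub_C_ne_zero])
  have hsum := congrArg (fun s : Multiset ℂ => (s.map fun z => z.re * Real.logb 2 z.re).sum) hroots
  simp [Multiset.map_nsmul, Multiset.sum_nsmul] at hsum
  rw [vonNeumannEntropy, hsum]

theorem exists_isometry_diagonalization {ρ : Matrix α α ℂ} (hρ : ρ.IsHermitian) :
    ∃ u : Matrix α α ℂ, u.conjTranspose * u = 1 ∧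
      ρ = u * Matrix.diagonal (fun k => (hρ.eigenvalues k : ℂ)) * u.conjTranspose := by
  refine ⟨hρ.eigenvectorUnitary, ?_, ?_⟩
  · exact Unitary.coe_star_mul_self hρ.eigenvectorUnitary
  · conv_lhs => rw [hρ.spectral_theorem, Unitary.conjStarAlgAut_apply]
    rfl

theorem vonNeumannEntropy_congr {ρ σ : Matrix α α ℂ} (hρ : ρ.IsHermitian) (h : ρ = σ) :
    vonNeumannEntropy ρ hρ = vonNeumannEntropy σ (h ▸ hρ) := by
  subst h
  rfl

theorem sum_eigenvalues_eq_one {ρ : Matrix α α ℂ} (hρ : ρ.IsHermitian) (htr : ρ.trace = 1) :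
    ∑ k, hρ.eigenvalues k = 1 := by
  have := hρ.trace_eq_sum_eigenvalues
  rw [htr] at this
  simpa using (congrArg Complex.re this).symm

theorem vonNeumannEntropy_nonneg {ρ : Matrix α α ℂ} (hρ : ρ.PosSemidef) (htr : ρ.trace = 1) :
    0 ≤ vonNeumannEntropy ρ hρ.1 := by
  have h1 := sum_eigenvalues_eq_one hρ.1 htr
  rw [vonNeumannEntropy, neg_nonneg]
  refine Finset.sum_nonpos fun k _ => mul_nonpos_of_nonneg_of_nonpos (hρ.eigenvalues_nonneg k) ?_
  refine Real.logb_nonpos one_lt_two (hρ.eigenvalues_nonneg k) ?_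
  rw [← h1]
  exact Finset.single_le_sum (fun j _ => hρ.eigenvalues_nonneg j) (Finset.mem_univ k)

/-- Two eigenvalues with sum 1 are fixed, up to order, by their product. -/
theorem vonNeumannEntropy_eq_binEntropy {ρ : Matrix α α ℂ} (hρ : ρ.IsHermitian)
    (e : α ≃ Fin 2) (htr : ρ.trace = 1) {δ : ℝ} (hdet : ρ.det = δ) :
    ∃ t : ℝ, t * (1 - t) = δ ∧ vonNeumannEntropy ρ hρ = Real.binEntropy t / Real.log 2 := by
  have h1 := sum_eigenvalues_eq_one hρ htr
  have h2 : ∏ k, hρ.eigenvalues k = δ := by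
    have := hρ.det_eq_prod_eigenvalues
    rw [hdet] at this
    exact Complex.ofReal_injective (by rw [this, Complex.ofReal_prod]; rfl)
  rw [← e.symm.sum_comp, Fin.sum_univ_two] at h1
  rw [← e.symm.prod_comp, Fin.prod_univ_two] at h2
  have h3 : hρ.eigenvalues (e.symm 1) = 1 - hρ.eigenvalues (e.symm 0) := by linarith
  refine ⟨hρ.eigenvalues (e.symm 0), by rw [← h3, h2], ?_⟩
  rw [vonNeumannEntropy, ← e.symm.sum_comp, Fin.sum_univ_two, h3, Real.binEntropy, Real.logb,
    Real.logb, Real.log_inv, Real.log_inv]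
  ring

/-- The Leibniz rule for `x ↦ -x log x`. -/
theorem negMulLog_prod {C : Type*} [DecidableEq C] (s : Finset C) (d : C → ℝ) :
    Real.negMulLog (∏ c ∈ s, d c) =
      ∑ c ∈ s, ∏ b ∈ s, if b = c then Real.negMulLog (d b) else d b := by
  induction s using Finset.induction_on with
  | empty => simp
  | insert a s ha ih =>
    rw [Finset.prod_insert ha, Real.negMulLog_mul, ih, Finset.sum_insert ha,
      Finset.prod_insert ha, if_pos rfl, Finset.mul_sum, mul_comm]
    congr 1
    · congr 1
      exact Finset.prod_congr rfl fun b hb => by rw [if_neg (by rintro rfl; exact ha hb)]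
    · refine Finset.sum_congr rfl fun c hc => ?_
      rw [Finset.prod_insert ha, if_neg (by rintro rfl; exact ha hc)]

/-- In the Leibniz expansion of each term, every factor other than the differentiated one sums to 1.
-/
theorem sum_negMulLog_prod {C : Type*} [Fintype C] [DecidableEq C] {K : C → Type*}
    [∀ c, Fintype (K c)] (d : ∀ c, K c → ℝ) (hd : ∀ c, ∑ k, d c k = 1) :
    ∑ k : ∀ c, K c, Real.negMulLog (∏ c, d c (k c)) = ∑ c, ∑ k, Real.negMulLog (d c k) := by
  simp_rw [negMulLog_prod]
  rw [Finset.sum_comm]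
  refine Finset.sum_congr rfl fun c _ => ?_
  rw [← Fintype.prod_sum fun b k => if b = c then Real.negMulLog (d b k) else d b k,
    Finset.prod_eq_single c]
  · simp
  · intro b _ hb
    simp [hb, hd]
  · simp

theorem neg_sum_mul_logb {κ : Type*} [Fintype κ] (d : κ → ℝ) :
    -∑ k, d k * Real.logb 2 (d k) = (∑ k, Real.negMulLog (d k)) / Real.log 2 := by
  rw [Finset.sum_div, ← Finset.sum_neg_distrib]
  refine Finset.sum_congr rfl fun k _ => ?_
  rw [Real.negMulLog, Real.logb]
  ring

end Entropy

/-! ### Tensor products over a partition of the qubits. -/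

section Products

variable {C Q : Type*} {X : C → Type*}

/-- The maps `ι c` exhibit `Q` as the disjoint union of the types `X c`. -/
def IsPartition (ι : ∀ c, X c → Q) : Prop :=
  Function.Bijective fun p : Σ c, X c => ι p.1 p.2

/-- The part of the inclusion `ι c` that lands in the qubits satisfying `S`. -/
def restrictPart (ι : ∀ c, X c → Q) (S : Q → Prop) (c : C) :
    {a : X c // S (ι c a)} → {q : Q // S q} :=
  fun a => ⟨ι c a.1, a.2⟩

/-- Lets the tensor product formalism apply again to marginals. -/
theorem IsPartition.restrictPart {ι : ∀ c, X c → Q} (hι : IsPartition ι) (S : Q → Prop) :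
    IsPartition (restrictPart ι S) := by
  constructor
  · rintro ⟨c, a, ha⟩ ⟨c', a', ha'⟩ h
    have h1 : ι c a = ι c' a' := congrArg Subtype.val h
    have h2 := @hι.1 ⟨c, a⟩ ⟨c', a'⟩ h1
    obtain ⟨rfl, h3⟩ := Sigma.mk.inj_iff.mp h2
    cases h3
    rfl
  · rintro ⟨q, hq⟩
    obtain ⟨⟨c, a⟩, rfl⟩ := hι.2 q
    exact ⟨⟨c, a, hq⟩, rfl⟩

/-- Bit strings on a disjoint union are families of bit strings on the parts. -/
def IsPartition.bitsEquiv {ι : ∀ c, X c → Q} (hι : IsPartition ι) :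
    Bits Q ≃ ∀ c, Bits (X c) :=
  ((Equiv.ofBijective _ hι).arrowCongr (Equiv.refl (Fin 2))).symm.trans
    (Equiv.piCurry fun _ _ => Fin 2)

variable [Fintype C]

/-- The tensor product of matrices on the parts of a disjoint union. -/
def tensorMatrix (ι : ∀ c, X c → Q) (M : ∀ c, Matrix (Bits (X c)) (Bits (X c)) ℂ) :
    Matrix (Bits Q) (Bits Q) ℂ :=
  Matrix.of fun x y => ∏ c, M c (x ∘ ι c) (y ∘ ι c)

/-- The tensor product of kets on the parts of a disjoint union. -/
def tensorKet (ι : ∀ c, X c → Q) (φ : ∀ c, Bits (X c) → ℂ) (x : Bits Q) : ℂ :=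
  ∏ c, φ c (x ∘ ι c)

theorem ketbra_tensorKet (ι : ∀ c, X c → Q) (φ : ∀ c, Bits (X c) → ℂ) :
    ketbra (tensorKet ι φ) = tensorMatrix ι fun c => ketbra (φ c) := by
  ext x y
  simp [ketbra, tensorKet, tensorMatrix, Matrix.vecMulVec_apply, Finset.prod_mul_distrib]

variable [DecidableEq C] [Fintype Q] [DecidableEq Q] [∀ c, Fintype (X c)]
  [∀ c, DecidableEq (X c)]

/-- The restrictions of `x` to the parts run over all families of bit strings, so this is
distributivity. -/
theorem IsPartition.sum_prod {R : Type*} [CommSemiring R] {ι : ∀ c, X c → Q} (hι : IsPartition ι)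
    (f : ∀ c, Bits (X c) → R) :
    ∑ x : Bits Q, ∏ c, f c (x ∘ ι c) = ∏ c, ∑ y, f c y := by
  rw [Fintype.prod_sum, ← hι.bitsEquiv.sum_comp]
  rfl

theorem IsPartition.norm_tensorKet {ι : ∀ c, X c → Q} (hι : IsPartition ι)
    (φ : ∀ c, Bits (X c) → ℂ) (h : ∀ c, ∑ x, ‖φ c x‖ ^ 2 = 1) :
    ∑ x, ‖tensorKet ι φ x‖ ^ 2 = 1 := by
  simp_rw [tensorKet, norm_prod, ← Finset.prod_pow]
  rw [hι.sum_prod fun c x => ‖φ c x‖ ^ 2]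
  simp [h]

theorem IsPartition.reduceTo_tensorMatrix {ι : ∀ c, X c → Q} (hι : IsPartition ι)
    (S : Q → Prop) [DecidablePred S] (M : ∀ c, Matrix (Bits (X c)) (Bits (X c)) ℂ) :
    reduceTo S (tensorMatrix ι M) =
      tensorMatrix (_root_.restrictPart ι S) fun c => reduceTo (fun a => S (ι c a)) (M c) := by
  -- Gluing the kept and the traced-out bits commutes with restriction to a part, so the partial
  -- trace factors.
  have glue : ∀ (a : {q // S q} → Fin 2) (z : {q // ¬ S q} → Fin 2) (c : C),
      (Equiv.piEquivPiSubtypeProd S fun _ => Fin 2).symm (a, z) ∘ ι c =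
        (Equiv.piEquivPiSubtypeProd (fun a => S (ι c a)) fun _ => Fin 2).symm
          (a ∘ _root_.restrictPart ι S c, z ∘ _root_.restrictPart ι (fun q => ¬ S q) c) := by
    intro a z c
    ext b
    simp only [Function.comp_apply, Equiv.piEquivPiSubtypeProd_symm_apply, _root_.restrictPart]
  ext a a'
  simp only [reduceTo, tensorMatrix, Matrix.of_apply]
  simp_rw [glue]
  exact (hι.restrictPart fun q => ¬ S q).sum_prod fun c z =>
    M c ((Equiv.piEquivPiSubtypeProd (fun a => S (ι c a)) fun _ => Fin 2).symm
      (a ∘ _root_.restrictPart ι S c, z))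
      ((Equiv.piEquivPiSubtypeProd (fun a => S (ι c a)) fun _ => Fin 2).symm
      (a' ∘ _root_.restrictPart ι S c, z))

/-- The von Neumann entropy is additive on tensor products. -/
theorem IsPartition.vonNeumannEntropy_tensorMatrix {ι : ∀ c, X c → Q} (hι : IsPartition ι)
    (M : ∀ c, Matrix (Bits (X c)) (Bits (X c)) ℂ) (hM : ∀ c, (M c).IsHermitian)
    (htr : ∀ c, (M c).trace = 1) (h : (tensorMatrix ι M).IsHermitian) :
    vonNeumannEntropy (tensorMatrix ι M) h = ∑ c, vonNeumannEntropy (M c) (hM c) := by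
  choose u hu hMu using fun c => exists_isometry_diagonalization (hM c)
  -- Tensor products of eigenvectors diagonalize the product, with products of eigenvalues.
  rw [vonNeumannEntropy_eq_of_isometry h
    (Matrix.of fun x (k : ∀ c, Bits (X c)) => ∏ c, u c (x ∘ ι c) (k c))
    (fun k => ∏ c, (hM c).eigenvalues (k c)), neg_sum_mul_logb,
    sum_negMulLog_prod _ fun c => sum_eigenvalues_eq_one (hM c) (htr c), Finset.sum_div]
  · simp only [vonNeumannEntropy, neg_sum_mul_logb]
  · ext k l
    have := hι.sum_prod fun c x => star (u c x (k c)) * u c x (l c)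
    simp only [Matrix.mul_apply, Matrix.conjTranspose_apply, Matrix.of_apply, star_prod,
      ← Finset.prod_mul_distrib, this]
    have h1 : ∀ c, ∑ x, star (u c x (k c)) * u c x (l c) =
        if k c = l c then 1 else 0 := fun c => by
      have := congrFun (congrFun (hu c) (k c)) (l c)
      simpa [Matrix.mul_apply, Matrix.one_apply] using this
    simp_rw [h1, Fintype.prod_ite_zero, Matrix.one_apply, funext_iff]
    simp
  · ext x y
    have h1 : ∀ c, M c (x ∘ ι c) (y ∘ ι c) = ∑ k, u c (x ∘ ι c) k *
        ((hM c).eigenvalues k : ℂ) * star (u c (y ∘ ι c) k) := fun c => by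
      conv_lhs => rw [hMu c]
      simp [Matrix.mul_apply, Matrix.diagonal_apply]
    simp only [tensorMatrix, Matrix.of_apply, h1, Fintype.prod_sum]
    simp [Matrix.mul_apply, Matrix.diagonal_apply, Finset.prod_mul_distrib]

end Products

/-! ### Entropy of entanglement across a cut of the qubits. -/

section Reduction

open scoped ComplexOrder

variable {Q : Type*} [Fintype Q] [DecidableEq Q]

theorem reduceTo_ketbra_eq_reducedLeft (S : Q → Prop) [DecidablePred S] (φ : Bits Q → ℂ) :
    reduceTo S (ketbra φ) =
      reducedLeft (φ ∘ (Equiv.piEquivPiSubtypeProd S fun _ => Fin 2).symm) := by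
  ext a a'
  simp only [reduceTo, reducedLeft, ketbra, Matrix.of_apply, Matrix.vecMulVec_apply,
    Function.comp_apply, Pi.star_apply]

theorem reduceTo_ketbra_isHermitian (S : Q → Prop) [DecidablePred S] (φ : Bits Q → ℂ) :
    (reduceTo S (ketbra φ)).IsHermitian := by
  rw [reduceTo_ketbra_eq_reducedLeft]
  exact reducedLeft_isHermitian _

/-- The entropy of entanglement of a ket of qubits across a bipartite cut. -/
def cutEntropy (S : Q → Prop) [DecidablePred S] (φ : Bits Q → ℂ) : ℝ :=
  vonNeumannEntropy (reduceTo S (ketbra φ)) (reduceTo_ketbra_isHermitian S φ)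

theorem trace_reduceTo (S : Q → Prop) [DecidablePred S] (ρ : Matrix (Bits Q) (Bits Q) ℂ) :
    (reduceTo S ρ).trace = ρ.trace := by
  simp only [Matrix.trace, reduceTo, Matrix.diag_apply, Matrix.of_apply]
  rw [← Fintype.sum_prod_type', ← (Equiv.piEquivPiSubtypeProd S fun _ => Fin 2).symm.sum_comp]

theorem trace_ketbra {α : Type*} [Fintype α] (φ : α → ℂ) (h : ∑ x, ‖φ x‖ ^ 2 = 1) :
    (ketbra φ).trace = 1 := by
  simp only [Matrix.trace, ketbra, Matrix.diag_apply, Matrix.vecMulVec_apply, Pi.star_apply,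
    RCLike.star_def, Complex.mul_conj']
  exact_mod_cast h

theorem reducedLeft_posSemidef {α β : Type*} [Fintype α] [Fintype β] (φ : α × β → ℂ) :
    (reducedLeft φ).PosSemidef := by
  have := Matrix.posSemidef_self_mul_conjTranspose (Matrix.of fun a b => φ (a, b))
  convert this using 1
  ext a a'
  simp [reducedLeft, ketbra, Matrix.vecMulVec_apply, Matrix.mul_apply]

theorem cutEntropy_nonneg (S : Q → Prop) [DecidablePred S] (φ : Bits Q → ℂ)
    (h : ∑ x, ‖φ x‖ ^ 2 = 1) : 0 ≤ cutEntropy S φ := by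
  have h1 : (reduceTo S (ketbra φ)).PosSemidef := by
    rw [reduceTo_ketbra_eq_reducedLeft]
    exact reducedLeft_posSemidef _
  exact vonNeumannEntropy_nonneg h1 ((trace_reduceTo S _).trans (trace_ketbra φ h))

/-- The entropy of entanglement is additive on tensor products. -/
theorem IsPartition.cutEntropy_tensorKet {C : Type*} {X : C → Type*} [Fintype C] [DecidableEq C]
    [∀ c, Fintype (X c)] [∀ c, DecidableEq (X c)] {ι : ∀ c, X c → Q} (hι : IsPartition ι)
    (S : Q → Prop) [DecidablePred S] (φ : ∀ c, Bits (X c) → ℂ)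
    (h : ∀ c, ∑ x, ‖φ c x‖ ^ 2 = 1) :
    cutEntropy S (tensorKet ι φ) = ∑ c, cutEntropy (fun a => S (ι c a)) (φ c) := by
  have h1 : reduceTo S (ketbra (tensorKet ι φ)) = tensorMatrix (_root_.restrictPart ι S)
      fun c => reduceTo (fun a => S (ι c a)) (ketbra (φ c)) := by
    rw [ketbra_tensorKet, hι.reduceTo_tensorMatrix]
  rw [cutEntropy, vonNeumannEntropy_congr _ h1,
    (hι.restrictPart S).vonNeumannEntropy_tensorMatrix _
      (fun c => reduceTo_ketbra_isHermitian _ (φ c))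
      fun c => (trace_reduceTo _ _).trans (trace_ketbra _ (h c))]
  rfl

end Reduction

/-! ### Entanglement of formation of pure states. -/

section PureStates

theorem trace_reducedLeft {α β : Type*} [Fintype α] [Fintype β] (φ : α × β → ℂ) : (reducedLeft φ).trace = (ketbra φ).trace := by
  simp only [Matrix.trace, reducedLeft, Matrix.diag_apply, Matrix.of_apply]
  rw [Fintype.sum_prod_type]

variable {α β : Type*} [Fintype α] [DecidableEq α] [Fintype β]

theorem eofPure_congr {φ ψ : α × β → ℂ} (h : ketbra φ = ketbra ψ) : eofPure φ = eofPure ψ := by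
  have h1 : reducedLeft φ = reducedLeft ψ := by rw [reducedLeft, h, ← reducedLeft]
  exact vonNeumannEntropy_congr _ h1

open scoped ComplexOrder in
theorem eofPure_nonneg (φ : α × β → ℂ) (h : ∑ x, ‖φ x‖ ^ 2 = 1) : 0 ≤ eofPure φ :=
  vonNeumannEntropy_nonneg (reducedLeft_posSemidef φ)
    ((trace_reducedLeft φ).trans (trace_ketbra φ h))

theorem eof_le {ρ : Matrix (α × β) (α × β) ℂ} {m : ℕ} (p : Fin m → ℝ) (φ : Fin m → α × β → ℂ)
    (hp : ∀ k, 0 ≤ p k) (hp1 : ∑ k, p k = 1) (hφ : ∀ k, ∑ x, ‖φ k x‖ ^ 2 = 1)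
    (hρ : ρ = ∑ k, (p k : ℂ) • ketbra (φ k)) : eof ρ ≤ ∑ k, p k * eofPure (φ k) := by
  refine csInf_le ⟨0, ?_⟩ ⟨m, p, φ, hp, hp1, hφ, hρ, rfl⟩
  rintro E ⟨m', p', φ', hp', -, hφ', -, rfl⟩
  exact Finset.sum_nonneg fun k _ => mul_nonneg (hp' k) (eofPure_nonneg _ (hφ' k))

open scoped ComplexOrder in
/-- A decomposition of a pure state into pure states is trivial. -/
theorem ketbra_eq_of_decomposition {γ : Type*} [Fintype γ] {m : ℕ} (ψ : γ → ℂ)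
    (hψ : ∑ x, ‖ψ x‖ ^ 2 = 1) (p : Fin m → ℝ) (φ : Fin m → γ → ℂ) (hp : ∀ k, 0 ≤ p k)
    (hφ : ∀ k, ∑ x, ‖φ k x‖ ^ 2 = 1) (h : ketbra ψ = ∑ k, (p k : ℂ) • ketbra (φ k))
    (k : Fin m) (hk : p k ≠ 0) : ketbra (φ k) = ketbra ψ := by
  have norm : ∀ χ : γ → ℂ, ∑ x, ‖χ x‖ ^ 2 = 1 → star χ ⬝ᵥ χ = 1 := fun χ hχ => by
    simp only [dotProduct, Pi.star_apply, RCLike.star_def, Complex.conj_mul']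
    exact_mod_cast hχ
  have form : ∀ χ w : γ → ℂ, star w ⬝ᵥ (ketbra χ).mulVec w =
      star (star χ ⬝ᵥ w) * (star χ ⬝ᵥ w) := fun χ w => by
    rw [ketbra, Matrix.vecMulVec_mulVec, Matrix.star_dotProduct]
    simp [mul_comm]
  set c := star ψ ⬝ᵥ φ k with hc
  -- The component of `φ k` orthogonal to `ψ`. Its expectation in `ketbra ψ` vanishes, hence so does
  -- each nonnegative term of the mixture, and `φ k` is orthogonal to `w` too; this forces `w = 0`.
  set w := φ k - c • ψ with hw
  have hψw : star ψ ⬝ᵥ w = 0 := by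
    rw [hw, dotProduct_sub, dotProduct_smul, norm ψ hψ, ← hc]
    simp
  have h0 : ∑ j, p j * ‖star (φ j) ⬝ᵥ w‖ ^ 2 = 0 := by
    have h1 := form ψ w
    rw [hψw, h, Matrix.sum_mulVec, dotProduct_sum] at h1
    simp only [Matrix.smul_mulVec, dotProduct_smul, form, RCLike.star_def, Complex.conj_mul',
      mul_zero, smul_eq_mul] at h1
    exact_mod_cast h1
  have h1 : star (φ k) ⬝ᵥ w = 0 := by
    have := (Finset.sum_eq_zero_iff_of_nonneg
      (fun j _ => mul_nonneg (hp j) (sq_nonneg ‖star (φ j) ⬝ᵥ w‖))).mp h0 k (Finset.mem_univ k)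
    simpa [hk] using this
  have h2 : w = 0 := by
    rw [← dotProduct_star_self_eq_zero]
    nth_rw 1 [hw]
    rw [star_sub, star_smul, sub_dotProduct, smul_dotProduct, h1, hψw]
    simp
  have h3 : φ k = c • ψ := sub_eq_zero.mp h2
  have h4 : star c * c = 1 := by
    have := norm (φ k) (hφ k)
    rw [h3, star_smul, smul_dotProduct, dotProduct_smul, norm ψ hψ] at this
    simpa using this
  ext x y
  simp only [h3, ketbra, Matrix.vecMulVec_apply, Pi.smul_apply, Pi.star_apply, smul_eq_mul,
    star_mul']
  linear_combination (ψ x * star (ψ y)) * h4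

/-- The entanglement of formation of a pure state is the entropy of its marginal. -/
theorem eofPure_le_eof_ketbra (ψ : α × β → ℂ) (hψ : ∑ x, ‖ψ x‖ ^ 2 = 1) :
    eofPure ψ ≤ eof (ketbra ψ) := by
  refine le_csInf ⟨_, 1, fun _ => 1, fun _ => ψ, by simp, by simp, by simpa using hψ, by simp,
    rfl⟩ ?_
  rintro E ⟨m, p, φ, hp, hp1, hφ, h, rfl⟩
  have h1 : ∀ k, p k * eofPure (φ k) = p k * eofPure ψ := fun k => by
    by_cases hk : p k = 0
    · simp [hk]
    · rw [eofPure_congr (ketbra_eq_of_decomposition ψ hψ p φ hp hφ h k hk)]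
  simp_rw [h1]
  rw [← Finset.sum_mul, hp1, one_mul]

end PureStates

/-! ### Upper bounds by explicit mixtures. -/

section Cuts

variable {Q : Type*} [Fintype Q] [DecidableEq Q] (S : Q → Prop) [DecidablePred S]

theorem eofPure_comp_symm (φ : Bits Q → ℂ) :
    eofPure (φ ∘ (Equiv.piEquivPiSubtypeProd S fun _ => Fin 2).symm) = cutEntropy S φ :=
  vonNeumannEntropy_congr _ (reduceTo_ketbra_eq_reducedLeft S φ).symm

theorem reindex_ketbra {α β : Type*} (e : α ≃ β) (φ : α → ℂ) :
    Matrix.reindex e e (ketbra φ) = ketbra (φ ∘ e.symm) := rfl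

theorem norm_comp_symm {α β : Type*} [Fintype α] [Fintype β] (e : α ≃ β) (φ : α → ℂ)
    (h : ∑ x, ‖φ x‖ ^ 2 = 1) : ∑ x, ‖(φ ∘ e.symm) x‖ ^ 2 = 1 :=
  (e.symm.sum_comp fun x => ‖φ x‖ ^ 2).trans h

theorem cutEntropy_le_eofCut (φ : Bits Q → ℂ) (h : ∑ x, ‖φ x‖ ^ 2 = 1) :
    cutEntropy S φ ≤ eofCut S (ketbra φ) := by
  rw [eofCut, reindex_ketbra, ← eofPure_comp_symm]
  exact eofPure_le_eof_ketbra _ (norm_comp_symm _ φ h)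

/-- The state `ρ` is a mixture of pure states of entanglement at most `E`. -/
def IsMixtureBelow (ρ : Matrix (Bits Q) (Bits Q) ℂ) (E : ℝ) : Prop :=
  ∃ (m : ℕ) (p : Fin m → ℝ) (φ : Fin m → Bits Q → ℂ), (∀ k, 0 ≤ p k) ∧ ∑ k, p k = 1 ∧
    (∀ k, ∑ x, ‖φ k x‖ ^ 2 = 1) ∧ ρ = ∑ k, (p k : ℂ) • ketbra (φ k) ∧
    ∀ k, cutEntropy S (φ k) ≤ E

variable {S}

theorem IsMixtureBelow.of_fintype {κ : Type*} [Fintype κ] {ρ : Matrix (Bits Q) (Bits Q) ℂ}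
    {E : ℝ} (p : κ → ℝ) (φ : κ → Bits Q → ℂ) (hp : ∀ k, 0 ≤ p k) (hp1 : ∑ k, p k = 1)
    (hφ : ∀ k, ∑ x, ‖φ k x‖ ^ 2 = 1) (hρ : ρ = ∑ k, (p k : ℂ) • ketbra (φ k))
    (hE : ∀ k, cutEntropy S (φ k) ≤ E) : IsMixtureBelow S ρ E := by
  let e := (Fintype.equivFin κ).symm
  refine ⟨Fintype.card κ, p ∘ e, φ ∘ e, fun k => hp _, ?_, fun k => hφ _, ?_, fun k => hE _⟩
  · rw [← hp1]
    exact e.sum_comp p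
  · rw [hρ]
    exact (e.sum_comp fun k => (p k : ℂ) • ketbra (φ k)).symm

theorem IsMixtureBelow.eofCut_le {ρ : Matrix (Bits Q) (Bits Q) ℂ} {E : ℝ}
    (h : IsMixtureBelow S ρ E) : eofCut S ρ ≤ E := by
  obtain ⟨m, p, φ, hp, hp1, hφ, hρ, hE⟩ := h
  have h1 := eof_le (ρ := Matrix.reindex (Equiv.piEquivPiSubtypeProd S fun _ => Fin 2)
    (Equiv.piEquivPiSubtypeProd S fun _ => Fin 2) ρ) p
    (fun k => φ k ∘ (Equiv.piEquivPiSubtypeProd S fun _ => Fin 2).symm) hp hp1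
    (fun k => norm_comp_symm _ _ (hφ k)) (by
      ext x y
      simp [hρ, Matrix.sum_apply, ketbra, Matrix.vecMulVec_apply])
  refine h1.trans ?_
  simp_rw [eofPure_comp_symm]
  calc ∑ k, p k * cutEntropy S (φ k) ≤ ∑ k, p k * E :=
        Finset.sum_le_sum fun k _ => mul_le_mul_of_nonneg_left (hE k) (hp k)
    _ = E := by rw [← Finset.sum_mul, hp1, one_mul]

/-- Products of members of the given decompositions form a decomposition. As the bound holds for
each member and not just on average, additivity of entropy gives the sum at once. -/
theorem IsPartition.isMixtureBelow {C : Type*} {X : C → Type*} [Fintype C] [DecidableEq C]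
    [∀ c, Fintype (X c)] [∀ c, DecidableEq (X c)] {ι : ∀ c, X c → Q} (hι : IsPartition ι)
    (ρ : ∀ c, Matrix (Bits (X c)) (Bits (X c)) ℂ) (E : C → ℝ)
    (h : ∀ c, IsMixtureBelow (fun a => S (ι c a)) (ρ c) (E c)) :
    IsMixtureBelow S (tensorMatrix ι ρ) (∑ c, E c) := by
  choose m p φ hp hp1 hφ hρ hE using h
  refine .of_fintype (κ := ∀ c, Fin (m c)) (fun k => ∏ c, p c (k c))
    (fun k => tensorKet ι fun c => φ c (k c)) (fun k => Finset.prod_nonneg fun c _ => hp c _) ?_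
    (fun k => hι.norm_tensorKet _ fun c => hφ c _) ?_ fun k => ?_
  · rw [← Fintype.prod_sum p]
    simp [hp1]
  · ext x y
    simp only [tensorMatrix, Matrix.of_apply, Matrix.sum_apply, Matrix.smul_apply, hρ,
      ketbra_tensorKet, Fintype.prod_sum, smul_eq_mul, Complex.ofReal_prod,
      Finset.prod_mul_distrib]
  · rw [hι.cutEntropy_tensorKet S _ fun c => hφ c _]
    exact Finset.sum_le_sum fun c _ => hE c _

/-- Every reduced state of a pure state is a mixture of pure states. -/
theorem exists_decomposition_reduceTo (R : Q → Prop) [DecidablePred R] (φ : Bits Q → ℂ)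
    (h : ∑ x, ‖φ x‖ ^ 2 = 1) :
    ∃ (p : ({q // ¬ R q} → Fin 2) → ℝ) (χ : ({q // ¬ R q} → Fin 2) → Bits {q // R q} → ℂ),
      (∀ z, 0 ≤ p z) ∧ ∑ z, p z = 1 ∧ (∀ z, ∑ x, ‖χ z x‖ ^ 2 = 1) ∧
      reduceTo R (ketbra φ) = ∑ z, (p z : ℂ) • ketbra (χ z) := by
  classical
  let ψ : ({q // ¬ R q} → Fin 2) → Bits {q // R q} → ℂ := fun z a =>
    φ ((Equiv.piEquivPiSubtypeProd R fun _ => Fin 2).symm (a, z))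
  let p : ({q // ¬ R q} → Fin 2) → ℝ := fun z => ∑ a, ‖ψ z a‖ ^ 2
  have hp : ∀ z, 0 ≤ p z := fun z => Finset.sum_nonneg fun a _ => sq_nonneg _
  -- The traced-out qubits are measured in the standard basis. An outcome of probability 0 gets an
  -- arbitrary basis ket, since every member must be normalized.
  refine ⟨p, fun z => if p z = 0 then Pi.single 0 1 else ((√(p z))⁻¹ : ℂ) • ψ z, hp, ?_,
    fun z => ?_, ?_⟩
  · rw [← h, ← (Equiv.piEquivPiSubtypeProd R fun _ => Fin 2).symm.sum_comp,
      Fintype.sum_prod_type_right]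
  · by_cases hz : p z = 0
    · simp only [hz, if_true]
      rw [Finset.sum_eq_single 0]
      · simp
      · intro b _ hb
        simp [hb]
      · simp
    · simp only [hz, if_false, Pi.smul_apply, norm_smul, mul_pow]
      rw [← Finset.mul_sum, norm_inv, Complex.norm_real, Real.norm_of_nonneg (Real.sqrt_nonneg _),
        inv_pow, Real.sq_sqrt (hp z)]
      exact inv_mul_cancel₀ hz
  · ext a a'
    simp only [reduceTo, Matrix.of_apply, Matrix.sum_apply, Matrix.smul_apply, ketbra,
      Matrix.vecMulVec_apply, Pi.star_apply]
    refine Finset.sum_congr rfl fun z _ => ?_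
    by_cases hz : p z = 0
    · have h1 : ∀ b, ψ z b = 0 := fun b => by
        have := (Finset.sum_eq_zero_iff_of_nonneg fun a _ => sq_nonneg ‖ψ z a‖).mp hz b
          (Finset.mem_univ b)
        simpa using this
      have h2 := h1 a
      simp only [ψ] at h2
      simp [hz, h2]
    · have h1 : (√(p z) : ℂ) ^ 2 = p z := by
        rw [← Complex.ofReal_pow, Real.sq_sqrt (hp z)]
      have h2 : (p z : ℂ) ≠ 0 := by exact_mod_cast hz
      simp only [hz, if_false, Pi.smul_apply, smul_eq_mul, star_mul', star_inv₀, RCLike.star_def,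
        Complex.conj_ofReal]
      rw [show ((p z : ℝ) : ℂ) * ((√(p z) : ℂ)⁻¹ * ψ z a * ((√(p z) : ℂ)⁻¹ *
          (starRingEnd ℂ) (ψ z a'))) = (p z : ℂ) * ((√(p z) : ℂ) ^ 2)⁻¹ *
          (ψ z a * (starRingEnd ℂ) (ψ z a')) by ring, h1, mul_inv_cancel₀ h2, one_mul]

/-- A product of normalized kets is not entangled. -/
theorem cutEntropy_eq_zero_of_product (φ : Bits Q → ℂ) (u : Bits {q // S q} → ℂ)
    (v : ({q // ¬ S q} → Fin 2) → ℂ) (hu : ∑ x, ‖u x‖ ^ 2 = 1) (hv : ∑ z, ‖v z‖ ^ 2 = 1)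
    (h : ∀ a z, φ ((Equiv.piEquivPiSubtypeProd S fun _ => Fin 2).symm (a, z)) = u a * v z) :
    cutEntropy S φ = 0 := by
  have hv' : ∑ z, v z * star (v z) = 1 := by
    simp only [RCLike.star_def, Complex.mul_conj']
    exact_mod_cast hv
  rw [cutEntropy, vonNeumannEntropy_eq_of_isometry _ (Matrix.of fun x (_ : Unit) => u x)
    (fun _ => 1)]
  · simp
  · ext
    simp only [Matrix.mul_apply, Matrix.conjTranspose_apply, Matrix.of_apply, RCLike.star_def,
      Complex.conj_mul', Matrix.one_apply_eq]
    exact_mod_cast hu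
  · ext a a'
    simp only [reduceTo, ketbra, Matrix.vecMulVec_apply, Matrix.of_apply, Pi.star_apply, h,
      star_mul']
    rw [show (∑ z, u a * v z * (star (u a') * star (v z))) =
        u a * star (u a') * ∑ z, v z * star (v z) by
      rw [Finset.mul_sum]; exact Finset.sum_congr rfl fun z _ => by ring, hv']
    simp [Matrix.mul_apply]

theorem cutEntropy_eq_zero_of_trivial (hS : (∀ q, ¬ S q) ∨ ∀ q, S q) (φ : Bits Q → ℂ)
    (h : ∑ x, ‖φ x‖ ^ 2 = 1) : cutEntropy S φ = 0 := by
  rw [← (Equiv.piEquivPiSubtypeProd S fun _ => Fin 2).symm.sum_comp] at h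
  rcases hS with hS | hS
  · have : IsEmpty {q // S q} := ⟨fun q => hS q.1 q.2⟩
    refine cutEntropy_eq_zero_of_product φ (fun _ => 1)
      (fun z => φ ((Equiv.piEquivPiSubtypeProd S fun _ => Fin 2).symm (default, z))) (by simp) ?_
      fun a z => by rw [one_mul, Subsingleton.elim a default]
    rw [← h, Fintype.sum_prod_type]
    exact (Fintype.sum_subsingleton (fun x : Bits {q // S q} => ∑ z,
      ‖φ ((Equiv.piEquivPiSubtypeProd S fun _ => Fin 2).symm (x, z))‖ ^ 2) _).symm
  · have : IsEmpty {q // ¬ S q} := ⟨fun q => q.2 (hS q.1)⟩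
    refine cutEntropy_eq_zero_of_product φ
      (fun a => φ ((Equiv.piEquivPiSubtypeProd S fun _ => Fin 2).symm (a, default))) (fun _ => 1)
      ?_ (by simp) fun a z => by rw [mul_one, Subsingleton.elim z default]
    rw [← h, Fintype.sum_prod_type_right]
    exact (Fintype.sum_subsingleton (fun z : {q // ¬ S q} → Fin 2 => ∑ x,
      ‖φ ((Equiv.piEquivPiSubtypeProd S fun _ => Fin 2).symm (x, z))‖ ^ 2) _).symm

/-- When one side of the cut holds no qubit, no member of any decomposition is entangled. -/
theorem isMixtureBelow_of_trivial (R : Q → Prop) [DecidablePred R] {T : {q // R q} → Prop}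
    [DecidablePred T] (hT : (∀ q, ¬ T q) ∨ ∀ q, T q) (φ : Bits Q → ℂ)
    (h : ∑ x, ‖φ x‖ ^ 2 = 1) : IsMixtureBelow T (reduceTo R (ketbra φ)) 0 := by
  obtain ⟨p, χ, hp, hp1, hχ, hρ⟩ := exists_decomposition_reduceTo R φ h
  exact .of_fintype p χ hp hp1 hχ hρ fun z => (cutEntropy_eq_zero_of_trivial hT _ (hχ z)).le

end Cuts

/-! ### Cat states, covering EPR and GHZ states at once. -/

section Cat

/-- The cat state `(|0⋯0⟩ + |1⋯1⟩) / √2` of a set of qubits. -/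
def catKet (X : Type*) [Fintype X] (x : Bits X) : ℂ :=
  if ∃ b, ∀ a, x a = b then ((1 / √2 : ℝ) : ℂ) else 0

/-- The basis ket all of whose bits are `b`. -/
def constKet (X : Type*) [Fintype X] (b : Fin 2) (x : Bits X) : ℂ :=
  if ∀ a, x a = b then 1 else 0

theorem eprKet_eq_catKet : eprKet = catKet (Fin 2) := by
  funext x
  have : ∀ x : Fin 2 → Fin 2, (x = ![0, 0] ∨ x = ![1, 1]) ↔ ∃ b, ∀ a, x a = b := by decide
  by_cases h : ∃ b, ∀ a, x a = b
  · rw [eprKet, catKet, if_pos h, if_pos ((this x).mpr h)]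
  · rw [eprKet, catKet, if_neg h, if_neg (mt (this x).mp h)]

theorem ghzKet_eq_catKet : ghzKet = catKet (Fin 3) := by
  funext x
  have : ∀ x : Fin 3 → Fin 2, (x = ![0, 0, 0] ∨ x = ![1, 1, 1]) ↔ ∃ b, ∀ a, x a = b := by decide
  by_cases h : ∃ b, ∀ a, x a = b
  · rw [ghzKet, catKet, if_pos h, if_pos ((this x).mpr h)]
  · rw [ghzKet, catKet, if_neg h, if_neg (mt (this x).mp h)]

variable {X : Type*} [Fintype X]

/-- On an empty set of qubits the two constant kets coincide and the right side would be twice the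
left. -/
theorem catKet_eq_sum [Nonempty X] (x : Bits X) :
    catKet X x = ((1 / √2 : ℝ) : ℂ) * ∑ b, constKet X b x := by
  obtain ⟨a⟩ := ‹Nonempty X›
  by_cases h : ∃ b, ∀ a, x a = b
  · obtain ⟨b, hb⟩ := h
    have h1 : ∀ b', (∀ a, x a = b') ↔ b = b' := fun b' =>
      ⟨fun h => (hb a).symm.trans (h a), fun h => h ▸ hb⟩
    simp [catKet, constKet, h1]
  · rw [catKet, if_neg h, Finset.sum_eq_zero, mul_zero]
    intro b _
    rw [constKet, if_neg fun hb => h ⟨b, hb⟩]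

theorem constKet_eq_single (b : Fin 2) : constKet X b = Pi.single (fun _ => b) 1 := by
  ext x
  simp [constKet, Pi.single_apply, funext_iff]

theorem star_constKet (b : Fin 2) (x : Bits X) : star (constKet X b x) = constKet X b x := by
  rw [constKet]
  split_ifs <;> simp

theorem half_eq_mul : ((1 / √2 : ℝ) : ℂ) * ((1 / √2 : ℝ) : ℂ) = 1 / 2 := by
  rw [← Complex.ofReal_mul, div_mul_div_comm, Real.mul_self_sqrt zero_le_two]
  simp

theorem constKet_glue (S : X → Prop) [DecidablePred S] (b : Fin 2) (a : {q // S q} → Fin 2)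
    (z : {q // ¬ S q} → Fin 2) :
    constKet X b ((Equiv.piEquivPiSubtypeProd S fun _ => Fin 2).symm (a, z)) =
      constKet _ b a * constKet _ b z := by
  have : (∀ q, (Equiv.piEquivPiSubtypeProd S fun _ => Fin 2).symm (a, z) q = b) ↔
      (∀ q, a q = b) ∧ ∀ q, z q = b := by
    constructor
    · intro h
      refine ⟨fun q => ?_, fun q => ?_⟩
      · simpa [q.2] using h q
      · simpa [q.2] using h q
    · rintro ⟨h1, h2⟩ q
      by_cases hq : S q
      · simpa [hq] using h1 ⟨q, hq⟩
      · simpa [hq] using h2 ⟨q, hq⟩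
  simp only [constKet, this, ite_and, ite_mul, one_mul, zero_mul]

variable [DecidableEq X]

theorem norm_constKet (b : Fin 2) : ∑ x, ‖constKet X b x‖ ^ 2 = 1 := by
  rw [Finset.sum_eq_single (fun _ => b)]
  · simp [constKet]
  · intro x _ hx
    simp [constKet_eq_single, hx]
  · simp

theorem sum_constKet_mul_constKet [Nonempty X] (b b' : Fin 2) :
    ∑ x, constKet X b x * constKet X b' x = if b = b' then 1 else 0 := by
  rw [Finset.sum_eq_single (fun _ => b)]
  · simp [constKet]
  · intro x _ hx
    simp [constKet_eq_single, hx]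
  · simp

theorem norm_catKet [Nonempty X] : ∑ x, ‖catKet X x‖ ^ 2 = 1 := by
  have h : ((∑ x, ‖catKet X x‖ ^ 2 : ℝ) : ℂ) = 1 := by
    push_cast
    simp_rw [← Complex.mul_conj', catKet_eq_sum, map_mul, map_sum, Complex.conj_ofReal,
      ← RCLike.star_def, star_constKet, mul_mul_mul_comm, half_eq_mul, Finset.sum_mul_sum]
    rw [← Finset.mul_sum, Finset.sum_comm]
    simp_rw [Finset.sum_comm (s := (Finset.univ : Finset (Bits X))), sum_constKet_mul_constKet]
    simp
  exact_mod_cast h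

theorem cutEntropy_constKet (S : X → Prop) [DecidablePred S] (b : Fin 2) :
    cutEntropy S (constKet X b) = 0 :=
  cutEntropy_eq_zero_of_product _ _ _ (norm_constKet b) (norm_constKet b) (constKet_glue S b)

/-- The cross terms vanish because the two constant kets are orthogonal on the nonempty set of
traced-out qubits. -/
theorem reduceTo_catKet (S : X → Prop) [DecidablePred S] (h : ∃ q, ¬ S q) :
    reduceTo S (ketbra (catKet X)) = ∑ b, ((1 / 2 : ℝ) : ℂ) • ketbra (constKet _ b) := by
  obtain ⟨q, hq⟩ := h
  have : Nonempty X := ⟨q⟩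
  have : Nonempty {q // ¬ S q} := ⟨⟨q, hq⟩⟩
  ext a a'
  simp only [reduceTo, ketbra, Matrix.of_apply, Matrix.vecMulVec_apply, Pi.star_apply,
    catKet_eq_sum, constKet_glue, star_mul', star_sum, star_constKet, RCLike.star_def,
    Complex.conj_ofReal, Matrix.sum_apply, Matrix.smul_apply]
  simp only [mul_mul_mul_comm, half_eq_mul, Finset.sum_mul_sum, ← Finset.mul_sum]
  simp_rw [Finset.sum_comm (s := (Finset.univ : Finset ({q // ¬ S q} → Fin 2))),
    ← Finset.mul_sum, sum_constKet_mul_constKet]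
  simp [mul_add]

theorem cutEntropy_catKet (S : X → Prop) [DecidablePred S] (h : ∃ q, S q) (h' : ∃ q, ¬ S q) :
    cutEntropy S (catKet X) = 1 := by
  obtain ⟨q, hq⟩ := h
  have : Nonempty {q // S q} := ⟨⟨q, hq⟩⟩
  rw [cutEntropy, vonNeumannEntropy_eq_of_isometry _
    (Matrix.of fun x b => constKet {q // S q} b x) (fun _ => 1 / 2)]
  · simp [Real.logb_inv]
  · ext b b'
    simp only [Matrix.mul_apply, Matrix.conjTranspose_apply, Matrix.of_apply, star_constKet,
      sum_constKet_mul_constKet, Matrix.one_apply]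
  · rw [reduceTo_catKet S h']
    ext a a'
    simp [Matrix.mul_apply, ketbra, Matrix.vecMulVec_apply, Matrix.diagonal_apply]
    ring

/-- Constant kets are products across every cut. This is why three-party GHZ states cost nothing on
the side of the pairs. -/
theorem isMixtureBelow_catKet_zero (R : X → Prop) [DecidablePred R] (h : ∃ q, ¬ R q)
    (T : {q // R q} → Prop) [DecidablePred T] :
    IsMixtureBelow T (reduceTo R (ketbra (catKet X))) 0 :=
  .of_fintype (fun _ : Fin 2 => 1 / 2) (constKet _) (by norm_num) (by norm_num) norm_constKet
    (reduceTo_catKet R h) fun b => (cutEntropy_constKet T b).le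

theorem isMixtureBelow_catKet_one (R : X → Prop) [DecidablePred R] (h : ∀ q, R q)
    (T : {q // R q} → Prop) [DecidablePred T] (h1 : ∃ q, T q) (h2 : ∃ q, ¬ T q) :
    IsMixtureBelow T (reduceTo R (ketbra (catKet X))) 1 := by
  have : Nonempty {q // R q} := ⟨h1.choose⟩
  have : IsEmpty {q // ¬ R q} := ⟨fun q => q.2 (h q.1)⟩
  refine .of_fintype (fun _ : Unit => 1) (fun _ => catKet _) (by simp) (by simp)
    (fun _ => norm_catKet) ?_ fun _ => (cutEntropy_catKet T h1 h2).le
  have glue : ∀ (a : {q // R q} → Fin 2) (z : {q // ¬ R q} → Fin 2),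
      catKet X ((Equiv.piEquivPiSubtypeProd R fun _ => Fin 2).symm (a, z)) = catKet _ a := by
    intro a z
    simp [catKet, h]
  ext a a'
  simp [reduceTo, ketbra, Matrix.vecMulVec_apply, glue]

end Cat

/-! ### Numerical estimate of the entanglement of a W marginal. -/

section Numeric

/-- From 2^14 = 16384 and 7^5 = 16807. -/
theorem log_seven_bound : 14 * Real.log 2 ≤ 5 * Real.log 7 := by
  have := Real.log_le_log (by norm_num) (by norm_num : (2 : ℝ) ^ 14 ≤ 7 ^ 5)
  rw [Real.log_pow, Real.log_pow] at this
  exact_mod_cast this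

theorem log_three_bound : 19 * Real.log 2 ≤ 12 * Real.log 3 := by
  have := Real.log_le_log (by norm_num) (by norm_num : (2 : ℝ) ^ 19 ≤ 3 ^ 12)
  rw [Real.log_pow, Real.log_pow] at this
  exact_mod_cast this

/-- Gibbs' inequality for two outcomes. -/
theorem binEntropy_le_cross {t p : ℝ} (ht : 0 < t) (ht1 : t < 1) (hp : 0 < p) (hp1 : p < 1) :
    Real.binEntropy t ≤ -(t * Real.log p) - (1 - t) * Real.log (1 - p) := by
  have h1 := mul_le_mul_of_nonneg_left (Real.log_le_sub_one_of_pos (div_pos hp ht)) ht.le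
  have h2 := mul_le_mul_of_nonneg_left
    (Real.log_le_sub_one_of_pos (div_pos (sub_pos.mpr hp1) (sub_pos.mpr ht1))) (sub_pos.mpr ht1).le
  rw [Real.log_div hp.ne' ht.ne'] at h1
  rw [Real.log_div (sub_pos.mpr hp1).ne' (sub_pos.mpr ht1).ne'] at h2
  have h3 : t * (p / t - 1) = p - t := by field_simp
  have h4 : (1 - t) * ((1 - p) / (1 - t) - 1) = t - p := by
    have := (sub_pos.mpr ht1).ne'
    field_simp
    ring
  rw [Real.binEntropy, Real.log_inv, Real.log_inv]
  linarith

/-- Half of `h(1/3) + 1/5`, an upper bound of the entanglement of a two-party W marginal. -/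
def wMarginalBound : ℝ := (Real.binEntropy (1 / 3) / Real.log 2 + 1 / 5) / 2

theorem binEntropy_third : Real.binEntropy (1 / 3) = Real.log 3 - 2 / 3 * Real.log 2 := by
  rw [Real.binEntropy, show (1 - 1 / 3 : ℝ)⁻¹ = 3 / 2 by norm_num,
    show (1 / 3 : ℝ)⁻¹ = 3 by norm_num, Real.log_div (by norm_num) (by norm_num)]
  ring

/-- With log₂ 7 ≥ 14/5 and log₂ 3 ≥ 19/12 the left side is below 0.557 and the right side above
0.558. -/
theorem binEntropy_div_log_le {t : ℝ} (h : t * (1 - t) = 1 / 9) :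
    Real.binEntropy t / Real.log 2 ≤ wMarginalBound := by
  wlog ht : 1 / 2 ≤ t generalizing t
  · rw [← Real.binEntropy_one_sub]
    exact this (by linarith) (by linarith)
  have hlog : 0 < Real.log 2 := Real.log_pos one_lt_two
  -- The larger root is (3 + √5)/6 = 0.87267...
  have h1 : 0.8726 ≤ t := by nlinarith
  have h2 : t < 1 := by nlinarith
  -- 7/8 is close to `t`, and its cross entropy involves only log 2 and log 7.
  have h3 := binEntropy_le_cross (by linarith) h2 (by norm_num : (0 : ℝ) < 7 / 8) (by norm_num)
  have h8 : Real.log 8 = 3 * Real.log 2 := by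
    rw [show (8 : ℝ) = 2 ^ 3 by norm_num, Real.log_pow]
    norm_num
  rw [show (1 - 7 / 8 : ℝ) = 1 / 8 by norm_num, Real.log_div (by norm_num) (by norm_num),
    Real.log_div (by norm_num) (by norm_num), h8, Real.log_one] at h3
  have h4 : 0.8726 * Real.log 7 ≤ t * Real.log 7 :=
    mul_le_mul_of_nonneg_right h1 (Real.log_nonneg (by norm_num))
  have h5 := log_seven_bound
  have h6 := log_three_bound
  rw [wMarginalBound, binEntropy_third, div_le_iff₀ hlog]
  have h7 : ((Real.log 3 - 2 / 3 * Real.log 2) / Real.log 2 + 1 / 5) / 2 * Real.log 2 =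
      (Real.log 3 - 2 / 3 * Real.log 2 + 1 / 5 * Real.log 2) / 2 := by
    field_simp
  rw [h7]
  linarith

theorem binEntropy_eq_third {t : ℝ} (h : t * (1 - t) = 2 / 9) :
    Real.binEntropy t = Real.binEntropy (1 / 3) := by
  have h1 : (t - 1 / 3) * (t - (1 - 1 / 3)) = 0 := by linarith
  rcases mul_eq_zero.mp h1 with h2 | h2
  · rw [sub_eq_zero.mp h2]
  · rw [sub_eq_zero.mp h2, Real.binEntropy_one_sub]

end Numeric

/-! ### Permutation-symmetric kets, with partial traces computed by counting ones. -/

section Weight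

/-- The number of ones in a bit string. -/
def bitWeight {X : Type*} [Fintype X] (x : X → Fin 2) : ℕ := ∑ a, (x a : ℕ)

/-- A ket whose coordinates depend only on the number of ones. -/
def weightKet (X : Type*) [Fintype X] (f : ℕ → ℂ) (x : Bits X) : ℂ := f (bitWeight x)

theorem sum_bitWeight_fin_succ {M : Type*} [AddCommMonoid M] (k : ℕ) (f : ℕ → M) :
    ∑ x : Fin (k + 1) → Fin 2, f (bitWeight x) =
      ∑ x : Fin k → Fin 2, f (bitWeight x) + ∑ x : Fin k → Fin 2, f (bitWeight x + 1) := by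
  rw [← (Fin.consEquiv fun _ => Fin 2).sum_comp, Fintype.sum_prod_type, Fin.sum_univ_two]
  simp [Fin.consEquiv, bitWeight, Fin.sum_univ_succ, add_comm]

variable {X : Type*} [Fintype X]

theorem bitWeight_le (x : X → Fin 2) : bitWeight x ≤ Fintype.card X := by
  rw [bitWeight, Fintype.card_eq_sum_ones]
  exact Finset.sum_le_sum fun a _ => Nat.lt_succ_iff.mp (x a).isLt

theorem bitWeight_glue (S : X → Prop) [DecidablePred S] (a : {q // S q} → Fin 2)
    (z : {q // ¬ S q} → Fin 2) :
    bitWeight ((Equiv.piEquivPiSubtypeProd S fun _ => Fin 2).symm (a, z)) =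
      bitWeight a + bitWeight z := by
  rw [bitWeight, ← Fintype.sum_subtype_add_sum_subtype S]
  congr 1
  · exact Finset.sum_congr rfl fun q _ => by simp [q.2]
  · exact Finset.sum_congr rfl fun q _ => by simp [q.2]

variable [DecidableEq X]

theorem sum_bitWeight {M : Type*} [AddCommMonoid M] {k : ℕ} (h : Fintype.card X = k)
    (f : ℕ → M) : ∑ x : X → Fin 2, f (bitWeight x) = ∑ x : Fin k → Fin 2, f (bitWeight x) := by
  let e := (Fintype.equivFinOfCardEq h).symm
  rw [← (e.arrowCongr (Equiv.refl (Fin 2))).sum_comp]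
  refine Finset.sum_congr rfl fun x _ => ?_
  congr 1
  exact e.symm.sum_comp fun a => (x a : ℕ)

theorem sum_bitWeight_one {M : Type*} [AddCommMonoid M] (h : Fintype.card X = 1) (f : ℕ → M) :
    ∑ x : X → Fin 2, f (bitWeight x) = f 0 + f 1 := by
  rw [sum_bitWeight h, sum_bitWeight_fin_succ]
  simp [bitWeight]

theorem sum_bitWeight_two {M : Type*} [AddCommMonoid M] (h : Fintype.card X = 2) (f : ℕ → M) :
    ∑ x : X → Fin 2, f (bitWeight x) = f 0 + f 1 + (f 1 + f 2) := by
  rw [sum_bitWeight h, sum_bitWeight_fin_succ, sum_bitWeight_fin_succ,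
    sum_bitWeight_fin_succ 0 fun w => f (w + 1)]
  simp [bitWeight]

theorem sum_bitWeight_three {M : Type*} [AddCommMonoid M] (h : Fintype.card X = 3) (f : ℕ → M) :
    ∑ x : X → Fin 2, f (bitWeight x) =
      f 0 + f 1 + (f 1 + f 2) + (f 1 + f 2 + (f 2 + f 3)) := by
  rw [sum_bitWeight h, sum_bitWeight_fin_succ, sum_bitWeight_two (by simp) f,
    sum_bitWeight_two (by simp) fun w => f (w + 1)]

theorem reduceTo_weightKet (S : X → Prop) [DecidablePred S] (f : ℕ → ℂ)
    (a a' : Bits {q // S q}) : reduceTo S (ketbra (weightKet X f)) a a' =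
      ∑ z : {q // ¬ S q} → Fin 2,
        f (bitWeight a + bitWeight z) * star (f (bitWeight a' + bitWeight z)) := by
  simp only [reduceTo, ketbra, weightKet, Matrix.of_apply, Matrix.vecMulVec_apply, Pi.star_apply,
    bitWeight_glue]

/-- The entropy of one qubit whose density matrix has determinant `δ`. -/
theorem exists_vonNeumannEntropy_eq_of_weight (h : Fintype.card X = 1)
    {ρ : Matrix (Bits X) (Bits X) ℂ} (hρ : ρ.IsHermitian) (m : ℕ → ℕ → ℂ)
    (hm : ∀ x y, ρ x y = m (bitWeight x) (bitWeight y)) (htr : m 0 0 + m 1 1 = 1) {δ : ℝ}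
    (hδ : m 0 0 * m 1 1 - m 0 1 * m 1 0 = δ) :
    ∃ t : ℝ, t * (1 - t) = δ ∧ vonNeumannEntropy ρ hρ = Real.binEntropy t / Real.log 2 := by
  obtain ⟨a, ha⟩ := Fintype.card_eq_one_iff.mp h
  let _ : Unique X := ⟨⟨a⟩, ha⟩
  let e : Bits X ≃ Fin 2 := Equiv.funUnique X (Fin 2)
  have he : ∀ b, bitWeight (e.symm b) = (b : ℕ) := fun b => by
    rw [bitWeight, Fintype.sum_unique]
    rfl
  refine vonNeumannEntropy_eq_binEntropy hρ e ?_ ?_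
  · rw [Matrix.trace, ← e.symm.sum_comp, Fin.sum_univ_two]
    simpa [hm, he] using htr
  · rw [← Matrix.det_submatrix_equiv_self e.symm, Matrix.det_fin_two]
    simpa [hm, he] using hδ

end Weight

/-! ### The W state and its marginals. -/

section W

/-- The coordinate of the W state of three qubits on strings with a given number of ones. -/
def wCoeff (w : ℕ) : ℂ := if w = 1 then ((1 / √3 : ℝ) : ℂ) else 0

theorem wKet_eq_weightKet : wKet = weightKet (Fin 3) wCoeff := by
  funext x
  have : ∀ x : Fin 3 → Fin 2, (x = ![1, 0, 0] ∨ x = ![0, 1, 0] ∨ x = ![0, 0, 1]) ↔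
    (x 0 : ℕ) + x 1 + x 2 = 1 := by decide
  rw [wKet, weightKet, wCoeff, bitWeight, Fin.sum_univ_three, if_congr (this x) rfl rfl]

theorem third_eq_mul : ((1 / √3 : ℝ) : ℂ) * ((1 / √3 : ℝ) : ℂ) = 1 / 3 := by
  rw [← Complex.ofReal_mul, div_mul_div_comm, Real.mul_self_sqrt (by norm_num)]
  simp

theorem third_eq_sq : (1 / √3 : ℝ) ^ 2 = 1 / 3 := by
  rw [div_pow, Real.sq_sqrt (by norm_num), one_pow]

variable {X : Type*} [Fintype X] [DecidableEq X]

theorem norm_wKet (hX : Fintype.card X = 3) : ∑ x, ‖weightKet X wCoeff x‖ ^ 2 = 1 := by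
  rw [show (∑ x, ‖weightKet X wCoeff x‖ ^ 2) = _ from
    sum_bitWeight_three hX fun w => ‖wCoeff w‖ ^ 2]
  simp only [wCoeff, if_true, Complex.norm_real, Real.norm_eq_abs, sq_abs, third_eq_sq]
  norm_num

theorem star_wCoeff (w : ℕ) : star (wCoeff w) = wCoeff w := by
  rw [wCoeff]
  split_ifs <;> simp

theorem wCoeff_mul (w w' : ℕ) : wCoeff w * wCoeff w' = if w = 1 ∧ w' = 1 then 1 / 3 else 0 := by
  by_cases h : w = 1
  · by_cases h' : w' = 1
    · rw [wCoeff, wCoeff, if_pos h, if_pos h', if_pos ⟨h, h'⟩, third_eq_mul]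
    · simp [wCoeff, h']
  · simp [wCoeff, h]

theorem cutEntropy_wKet (hX : Fintype.card X = 3) (S : X → Prop) [DecidablePred S]
    (h : Fintype.card {q // S q} = 1) :
    cutEntropy S (weightKet X wCoeff) = Real.binEntropy (1 / 3) / Real.log 2 := by
  have h' : Fintype.card {q // ¬ S q} = 2 := by rw [Fintype.card_subtype_compl, hX, h]
  -- The one-qubit marginal is diag(2/3, 1/3), of determinant 2/9.
  obtain ⟨t, ht, hS⟩ := exists_vonNeumannEntropy_eq_of_weight h
    (reduceTo_ketbra_isHermitian S (weightKet X wCoeff))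
    (fun i j => wCoeff (i + 0) * wCoeff (j + 0) + wCoeff (i + 1) * wCoeff (j + 1) +
      (wCoeff (i + 1) * wCoeff (j + 1) + wCoeff (i + 2) * wCoeff (j + 2))) (δ := 2 / 9)
    (fun x y => by
      rw [reduceTo_weightKet]
      simp_rw [star_wCoeff]
      exact sum_bitWeight_two h' fun w => wCoeff (bitWeight x + w) * wCoeff (bitWeight y + w))
    (by simp only [wCoeff_mul]; norm_num) (by simp only [wCoeff_mul]; norm_num)
  rw [cutEntropy, hS, binEntropy_eq_third ht]

/-- The coordinates of `(|00⟩ + s |01⟩ + s |10⟩) / √3` in terms of the number of ones. -/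
def wPairCoeff (s : Fin 2) (w : ℕ) : ℂ :=
  (if w = 0 then 1 else if w = 1 then (-1) ^ (s : ℕ) else 0) * ((1 / √3 : ℝ) : ℂ)

theorem star_wPairCoeff (s : Fin 2) (w : ℕ) : star (wPairCoeff s w) = wPairCoeff s w := by
  rw [wPairCoeff]
  split_ifs <;> simp

theorem wPairCoeff_mul (s : Fin 2) (w w' : ℕ) : wPairCoeff s w * wPairCoeff s w' =
    (if w = 0 then 1 else if w = 1 then (-1) ^ (s : ℕ) else 0) *
      (if w' = 0 then 1 else if w' = 1 then (-1) ^ (s : ℕ) else 0) * (1 / 3) := by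
  rw [wPairCoeff, wPairCoeff, mul_mul_mul_comm, third_eq_mul]

theorem norm_wPairCoeff (s : Fin 2) (w : ℕ) :
    ‖wPairCoeff s w‖ ^ 2 = if w ≤ 1 then 1 / 3 else 0 := by
  rw [wPairCoeff, norm_mul, mul_pow, Complex.norm_real, Real.norm_eq_abs, sq_abs, third_eq_sq]
  rcases w with _ | _ | w <;> simp

theorem cutEntropy_wPair (hX : Fintype.card X = 2) (S : X → Prop) [DecidablePred S]
    (h : Fintype.card {q // S q} = 1) (s : Fin 2) :
    cutEntropy S (weightKet X (wPairCoeff s)) ≤ wMarginalBound := by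
  have h' : Fintype.card {q // ¬ S q} = 1 := by rw [Fintype.card_subtype_compl, hX, h]
  -- The marginal has diagonal 2/3, 1/3 and off-diagonal entries ±1/3, so its determinant is 2/9 -
  -- 1/9 for both signs.
  obtain ⟨t, ht, hS⟩ := exists_vonNeumannEntropy_eq_of_weight h
    (reduceTo_ketbra_isHermitian S (weightKet X (wPairCoeff s)))
    (fun i j => wPairCoeff s (i + 0) * wPairCoeff s (j + 0) +
      wPairCoeff s (i + 1) * wPairCoeff s (j + 1)) (δ := 1 / 9)
    (fun x y => by
      rw [reduceTo_weightKet]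
      simp_rw [star_wPairCoeff]
      exact sum_bitWeight_one h' fun w =>
        wPairCoeff s (bitWeight x + w) * wPairCoeff s (bitWeight y + w))
    (by simp only [wPairCoeff_mul]; fin_cases s <;> norm_num)
    (by simp only [wPairCoeff_mul]; fin_cases s <;> norm_num)
  rw [cutEntropy, hS]
  exact binEntropy_div_log_le ht

/-- Averaging over the sign removes the coherence between |00⟩ and |01⟩ + |10⟩, which is what
tracing out a qubit of W does. -/
theorem isMixtureBelow_wKet (hX : Fintype.card X = 3) (R : X → Prop) [DecidablePred R]
    (hR : Fintype.card {q // R q} = 2) (T : {q // R q} → Prop) [DecidablePred T]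
    (hT : Fintype.card {q // T q} = 1) :
    IsMixtureBelow T (reduceTo R (ketbra (weightKet X wCoeff))) wMarginalBound := by
  have hR' : Fintype.card {q // ¬ R q} = 1 := by rw [Fintype.card_subtype_compl, hX, hR]
  refine .of_fintype (fun _ : Fin 2 => 1 / 2) (fun s => weightKet _ (wPairCoeff s)) (by norm_num)
    (by norm_num) (fun s => ?_) ?_ fun s => cutEntropy_wPair hR T hT s
  · rw [show (∑ x, ‖weightKet _ (wPairCoeff s) x‖ ^ 2) = _ from
      sum_bitWeight_two hR fun w => ‖wPairCoeff s w‖ ^ 2]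
    simp only [norm_wPairCoeff]
    norm_num
  · ext a a'
    rw [reduceTo_weightKet]
    simp_rw [star_wCoeff]
    rw [show (∑ z : {q // ¬ R q} → Fin 2, wCoeff (bitWeight a + bitWeight z) *
        wCoeff (bitWeight a' + bitWeight z)) = _ from sum_bitWeight_one hR' fun w =>
          wCoeff (bitWeight a + w) * wCoeff (bitWeight a' + w)]
    simp only [Matrix.sum_apply, Matrix.smul_apply, ketbra, Matrix.vecMulVec_apply, Pi.star_apply,
      weightKet, star_wPairCoeff, wPairCoeff_mul, wCoeff_mul, Fin.sum_univ_two]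
    have h1 := bitWeight_le a
    have h2 := bitWeight_le a'
    rw [hR] at h1 h2
    generalize bitWeight a = w at h1 ⊢
    generalize bitWeight a' = w' at h2 ⊢
    interval_cases w <;> interval_cases w' <;> norm_num

end W

/-! ### Contribution of a single shared state, and counting of marginals. -/

section Components

variable {n : ℕ} {X : Type*} [Fintype X] [DecidableEq X] (o : X → Fin n)

/-- The indicator that `i` holds a qubit of a state distributed by `o`. -/
def holds {n : ℕ} {X : Type*} [Fintype X] (o : X → Fin n) (i : Fin n) : ℝ :=
  if ∃ q, o q = i then 1 else 0

/-- A bound on the entanglement between `i` and `j` in a cat state distributed by `o`. -/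
def catPairBound {n : ℕ} {X : Type*} [Fintype X] (o : X → Fin n) (i j : Fin n) : ℝ :=
  if (∀ q, o q = i ∨ o q = j) ∧ (∃ q, o q = i) ∧ ∃ q, o q = j then 1 else 0

theorem isMixtureBelow_catPairBound [Nonempty X] {i j : Fin n} (hij : i ≠ j) :
    IsMixtureBelow (fun q : {q // o q = i ∨ o q = j} => o q.1 = i)
      (reduceTo (fun q => o q = i ∨ o q = j) (ketbra (catKet X))) (catPairBound o i j) := by
  by_cases h : ∀ q, o q = i ∨ o q = j
  · by_cases hi : ∃ q, o q = i
    · by_cases hj : ∃ q, o q = j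
      · rw [catPairBound, if_pos ⟨h, hi, hj⟩]
        obtain ⟨a, ha⟩ := hi
        obtain ⟨b, hb⟩ := hj
        exact isMixtureBelow_catKet_one _ h _ ⟨⟨a, Or.inl ha⟩, ha⟩
          ⟨⟨b, Or.inr hb⟩, fun h' => hij (h'.symm.trans hb)⟩
      · rw [catPairBound, if_neg fun h' => hj h'.2.2]
        exact isMixtureBelow_of_trivial _
          (Or.inr fun q => q.2.resolve_right fun h' => hj ⟨q, h'⟩) _ norm_catKet
    · rw [catPairBound, if_neg fun h' => hi h'.2.1]
      exact isMixtureBelow_of_trivial _ (Or.inl fun q h' => hi ⟨q, h'⟩) _ norm_catKet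
  · rw [catPairBound, if_neg fun h' => h h'.1]
    exact isMixtureBelow_catKet_zero _ (not_forall.mp h) _

theorem cutEntropy_catKet_owner (ho : ∃ a b, o a ≠ o b) (i : Fin n) :
    holds o i ≤ cutEntropy (fun q => o q = i) (catKet X) := by
  obtain ⟨a, b, hab⟩ := ho
  have : Nonempty X := ⟨a⟩
  rw [holds]
  split_ifs with h
  · refine (cutEntropy_catKet _ h ?_).ge
    by_contra! hall
    exact hab ((hall a).trans (hall b).symm)
  · exact cutEntropy_nonneg _ _ norm_catKet

/-- At most one `j` can own, together with `i`, all the qubits and at least one of them. -/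
theorem sum_catPairBound_le {n : ℕ} {X : Type*} [Fintype X] (o : X → Fin n) (i : Fin n) :
    ∑ j ∈ Finset.univ.erase i, catPairBound o i j ≤ holds o i := by
  rw [holds]
  by_cases h : ∃ j ∈ Finset.univ.erase i,
      (∀ q, o q = i ∨ o q = j) ∧ (∃ q, o q = i) ∧ ∃ q, o q = j
  · obtain ⟨j, hj, hj1, hi, hj2⟩ := h
    rw [Finset.sum_eq_single_of_mem j hj, catPairBound, if_pos ⟨hj1, hi, hj2⟩, if_pos hi]
    intro k hk hkj
    rw [catPairBound, if_neg]
    rintro ⟨-, -, q, rfl⟩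
    rcases hj1 q with h' | h'
    · exact (Finset.ne_of_mem_erase hk) h'
    · exact hkj h'
  · rw [Finset.sum_eq_zero]
    · split_ifs <;> norm_num
    · exact fun j hj => if_neg fun h' => h ⟨j, hj, h'⟩

theorem catPairBound_eq_zero {o : Fin 3 → Fin n} (ho : Function.Injective o) (i j : Fin n) :
    catPairBound o i j = 0 := by
  refine if_neg ?_
  rintro ⟨h, -⟩
  have h01 := ho.ne (show (0 : Fin 3) ≠ 1 by decide)
  have h02 := ho.ne (show (0 : Fin 3) ≠ 2 by decide)
  have h12 := ho.ne (show (1 : Fin 3) ≠ 2 by decide)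
  rcases h 0 with h0 | h0 <;> rcases h 1 with h1 | h1 <;> rcases h 2 with h2 | h2 <;> simp_all

/-- A bound on the entanglement between `i` and `j` in a W state distributed by `o`. -/
def wPairBound {n : ℕ} {X : Type*} [Fintype X] (o : X → Fin n) (i j : Fin n) : ℝ :=
  if (∃ q, o q = i) ∧ ∃ q, o q = j then wMarginalBound else 0

theorem isMixtureBelow_wPairBound (hX : Fintype.card X = 3) (ho : Function.Injective o)
    {i j : Fin n} (hij : i ≠ j) :
    IsMixtureBelow (fun q : {q // o q = i ∨ o q = j} => o q.1 = i)
      (reduceTo (fun q => o q = i ∨ o q = j) (ketbra (weightKet X wCoeff)))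
      (wPairBound o i j) := by
  by_cases hi : ∃ q, o q = i
  · by_cases hj : ∃ q, o q = j
    · rw [wPairBound, if_pos ⟨hi, hj⟩]
      obtain ⟨a, ha⟩ := hi
      obtain ⟨b, hb⟩ := hj
      refine isMixtureBelow_wKet hX _ ?_ _ ?_
      · rw [Fintype.card_subtype,
          ← Finset.card_pair fun h : a = b => hij (ha.symm.trans ((congrArg o h).trans hb))]
        congr 1
        ext q
        simp [← ha, ← hb, ho.eq_iff]
      · exact Fintype.card_eq_one_iff.mpr
          ⟨⟨⟨a, Or.inl ha⟩, ha⟩,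
            fun q => Subtype.ext (Subtype.ext (ho (q.2.trans ha.symm)))⟩
    · rw [wPairBound, if_neg fun h' => hj h'.2]
      exact isMixtureBelow_of_trivial _
        (Or.inr fun q => q.2.resolve_right fun h' => hj ⟨q, h'⟩) _ (norm_wKet hX)
  · rw [wPairBound, if_neg fun h' => hi h'.1]
    exact isMixtureBelow_of_trivial _ (Or.inl fun q h' => hi ⟨q, h'⟩) _ (norm_wKet hX)

theorem cutEntropy_wKet_owner (hX : Fintype.card X = 3) (ho : Function.Injective o) (i : Fin n) :
    holds o i * (Real.binEntropy (1 / 3) / Real.log 2) ≤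
      cutEntropy (fun q => o q = i) (weightKet X wCoeff) := by
  rw [holds, ite_mul, one_mul, zero_mul]
  split_ifs with h
  · obtain ⟨a, ha⟩ := h
    exact (cutEntropy_wKet hX _ (Fintype.card_eq_one_iff.mpr
      ⟨⟨a, ha⟩, fun q => Subtype.ext (ho (q.2.trans ha.symm))⟩)).ge
  · exact cutEntropy_nonneg _ _ (norm_wKet hX)

theorem card_other_owners {o : Fin 3 → Fin n} (ho : Function.Injective o) {i : Fin n}
    (hi : ∃ q, o q = i) : ((Finset.univ.erase i).filter fun j => ∃ q, o q = j).card = 2 := by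
  have : ((Finset.univ.erase i).filter fun j => ∃ q, o q = j) =
      (Finset.univ.image o).erase i := by
    ext j
    simp
  rw [this, Finset.card_erase_of_mem (by simpa using hi), Finset.card_image_of_injective _ ho]
  simp

/-- Each state of which `i` holds a qubit has two marginals between `i` and other parties. -/
theorem sum_card_marginals {V : Type*} [Fintype V] (P : V → Prop) [DecidablePred P]
    (o : V → Fin 3 → Fin n) (ho : ∀ v, P v → Function.Injective (o v)) (i : Fin n) :
    ∑ j ∈ Finset.univ.erase i,
        (Finset.univ.filter fun v => P v ∧ (∃ a, o v a = i) ∧ ∃ b, o v b = j).card =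
      2 * (Finset.univ.filter fun v => P v ∧ ∃ a, o v a = i).card := by
  simp_rw [Finset.card_filter]
  rw [Finset.sum_comm, Finset.mul_sum]
  refine Finset.sum_congr rfl fun v _ => ?_
  by_cases hv : P v ∧ ∃ a, o v a = i
  · rw [if_pos hv, mul_one, ← card_other_owners (ho v hv.1) hv.2, Finset.card_filter]
    exact Finset.sum_congr rfl fun j _ => by simp only [hv.1, hv.2, true_and]
  · rw [if_neg hv, mul_zero]
    exact Finset.sum_eq_zero fun j _ => if_neg fun h => hv ⟨h.1, h.2.1⟩

end Components

/-! ### The network as a tensor product of its components. -/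

namespace QuantumNetwork

variable {n : ℕ} (N : QuantumNetwork n)

/-- The EPR, GHZ and W states of the network. -/
abbrev Component : Type := Fin N.numEPR ⊕ Fin N.numGHZ ⊕ Fin N.numW

/-- The number of qubits of a component. -/
def size : N.Component → ℕ
  | Sum.inl _ => 2
  | Sum.inr _ => 3

/-- The qubits of a component. -/
def part : ∀ c : N.Component, Fin (N.size c) → N.Qubit
  | Sum.inl e => fun a => Sum.inl (e, a)
  | Sum.inr (Sum.inl g) => fun a => Sum.inr (Sum.inl (g, a))
  | Sum.inr (Sum.inr v) => fun a => Sum.inr (Sum.inr (v, a))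

/-- The state of a component. -/
def componentKet : ∀ c : N.Component, Bits (Fin (N.size c)) → ℂ
  | Sum.inl _ => catKet (Fin 2)
  | Sum.inr (Sum.inl _) => catKet (Fin 3)
  | Sum.inr (Sum.inr _) => weightKet (Fin 3) wCoeff

theorem isPartition_part : IsPartition N.part := by
  constructor
  · rintro ⟨e | g | v, a⟩ ⟨e' | g' | v', a'⟩ h <;> simp only [part] at h <;> cases h <;> rfl
  · rintro (⟨e, a⟩ | ⟨g, a⟩ | ⟨v, a⟩)
    · exact ⟨⟨Sum.inl e, a⟩, rfl⟩
    · exact ⟨⟨Sum.inr (Sum.inl g), a⟩, rfl⟩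
    · exact ⟨⟨Sum.inr (Sum.inr v), a⟩, rfl⟩

theorem ket_eq_tensorKet : N.ket = tensorKet N.part N.componentKet := by
  funext x
  rw [ket, tensorKet, Fintype.prod_sum_type, Fintype.prod_sum_type, ← mul_assoc, eprKet_eq_catKet,
    ghzKet_eq_catKet, wKet_eq_weightKet]
  rfl

theorem norm_componentKet (c : N.Component) : ∑ x, ‖N.componentKet c x‖ ^ 2 = 1 := by
  rcases c with e | g | v
  · exact norm_catKet (X := Fin 2)
  · exact norm_catKet (X := Fin 3)
  · exact norm_wKet (X := Fin 3) (by simp)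

theorem le_eofRest (i : Fin n) :
    ∑ e, holds (N.epr e) i + (∑ g, holds (N.ghz g) i +
      ∑ v, holds (N.w v) i * (Real.binEntropy (1 / 3) / Real.log 2)) ≤ N.eofRest i := by
  have h := cutEntropy_le_eofCut (fun q => N.owner q = i) N.ket (by
    rw [ket_eq_tensorKet]
    exact N.isPartition_part.norm_tensorKet _ N.norm_componentKet)
  refine le_trans ?_ h
  rw [ket_eq_tensorKet, N.isPartition_part.cutEntropy_tensorKet _ _ N.norm_componentKet,
    Fintype.sum_sum_type, Fintype.sum_sum_type]
  refine add_le_add (Finset.sum_le_sum fun e _ => ?_)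
    (add_le_add (Finset.sum_le_sum fun g _ => ?_) (Finset.sum_le_sum fun v _ => ?_))
  · exact cutEntropy_catKet_owner (N.epr e)
      ⟨0, 1, (N.epr_injective e).ne (by decide)⟩ i
  · exact cutEntropy_catKet_owner (N.ghz g) (N.ghz_shared g) i
  · exact cutEntropy_wKet_owner (N.w v) (by simp) (N.w_injective v) i

theorem eofPair_le {i j : Fin n} (hij : i ≠ j) :
    N.eofPair i j ≤ ∑ e, catPairBound (N.epr e) i j + (∑ g, catPairBound (N.ghz g) i j +
      ∑ v, wPairBound (N.w v) i j) := by
  have h1 : N.pairState i j = tensorMatrix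
      (restrictPart N.part fun q => N.owner q = i ∨ N.owner q = j) fun c =>
        reduceTo (fun a => N.owner (N.part c a) = i ∨ N.owner (N.part c a) = j)
          (ketbra (N.componentKet c)) := by
    rw [pairState, totalState, ket_eq_tensorKet, ketbra_tensorKet,
      N.isPartition_part.reduceTo_tensorMatrix]
  let E : N.Component → ℝ := Sum.elim (fun e => catPairBound (N.epr e) i j)
    (Sum.elim (fun g => catPairBound (N.ghz g) i j) fun v => wPairBound (N.w v) i j)
  have h2 : ∑ c, E c = ∑ e, catPairBound (N.epr e) i j + (∑ g, catPairBound (N.ghz g) i j +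
      ∑ v, wPairBound (N.w v) i j) := by
    rw [Fintype.sum_sum_type, Fintype.sum_sum_type]
    rfl
  rw [eofPair, h1, ← h2]
  refine ((N.isPartition_part.restrictPart _).isMixtureBelow _ E fun c => ?_).eofCut_le
  rcases c with e | g | v
  · exact isMixtureBelow_catPairBound (N.epr e) hij
  · exact isMixtureBelow_catPairBound (N.ghz g) hij
  · exact isMixtureBelow_wPairBound (N.w v) (by simp) (N.w_injective v) hij

/-- A GHZ state with three owners has no pair contribution, so each one at `i` leaves a surplus of
1. -/
theorem sum_ghz_le (i : Fin n) :
    ∑ g, ∑ j ∈ Finset.univ.erase i, catPairBound (N.ghz g) i j +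
      ((Finset.univ.filter fun g =>
        Function.Injective (N.ghz g) ∧ ∃ a, N.ghz g a = i).card : ℝ) ≤
      ∑ g, holds (N.ghz g) i := by
  rw [Finset.card_filter, Nat.cast_sum, ← Finset.sum_add_distrib]
  refine Finset.sum_le_sum fun g _ => ?_
  by_cases hg : Function.Injective (N.ghz g)
  · simp only [catPairBound_eq_zero hg, hg, holds, Finset.sum_const_zero, zero_add, true_and,
      Nat.cast_ite, Nat.cast_one, Nat.cast_zero]
    exact le_of_eq (by congr)
  · rw [if_neg fun h => hg h.1, Nat.cast_zero, add_zero]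
    exact sum_catPairBound_le (N.ghz g) i

theorem sum_ghzMarginals (i : Fin n) : ∑ j ∈ Finset.univ.erase i, N.ghzMarginals i j =
    2 * (Finset.univ.filter fun g =>
      Function.Injective (N.ghz g) ∧ ∃ a, N.ghz g a = i).card := by
  rw [← sum_card_marginals (fun g => Function.Injective (N.ghz g)) N.ghz (fun _ h => h)]
  rfl

theorem sum_wMarginals (i : Fin n) : ∑ j ∈ Finset.univ.erase i, N.wMarginals i j =
    2 * (Finset.univ.filter fun v => ∃ a, N.w v a = i).card := by
  simpa [wMarginals] using sum_card_marginals (fun _ => True) N.w (fun v _ => N.w_injective v) i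

theorem sum_wPairBound (i : Fin n) :
    ∑ v, ∑ j ∈ Finset.univ.erase i, wPairBound (N.w v) i j =
      2 * (Finset.univ.filter fun v => ∃ a, N.w v a = i).card * wMarginalBound := by
  have h := congrArg (fun k : ℕ => (k : ℝ) * wMarginalBound) (N.sum_wMarginals i)
  simp only [wMarginals, Finset.card_filter, Nat.cast_sum, Nat.cast_mul, Nat.cast_ofNat] at h ⊢
  rw [← h, Finset.sum_comm, Finset.sum_mul]
  refine Finset.sum_congr rfl fun j _ => ?_
  rw [Finset.sum_mul]
  exact Finset.sum_congr rfl fun v _ => by simp [wPairBound]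

end QuantumNetwork

end

/-! ### Balance of surplus and deficit. -/

theorem theoremS1 {n : ℕ} (N : QuantumNetwork n)
    (hWG : ∀ i j : Fin n, i ≠ j → N.wMarginals i j ≤ 5 * N.ghzMarginals i j) (i : Fin n) :
    ∑ j ∈ Finset.univ.erase i, N.eofPair i j ≤ N.eofRest i := by
  refine le_trans ?_ (N.le_eofRest i)
  refine (Finset.sum_le_sum fun j hj =>
    N.eofPair_le (Finset.ne_of_mem_erase hj).symm).trans ?_
  rw [Finset.sum_add_distrib, Finset.sum_add_distrib, Finset.sum_comm]
  refine add_le_add (Finset.sum_le_sum fun e _ => sum_catPairBound_le (N.epr e) i) ?_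
  rw [Finset.sum_comm, Finset.sum_comm (t := (Finset.univ : Finset (Fin N.numW))),
    N.sum_wPairBound]
  have hg := N.sum_ghz_le i
  -- Only the sum over `j` of the pairwise hypothesis matters; the factor 2 on both sides then
  -- cancels.
  have hcount := Finset.sum_le_sum fun j (hj : j ∈ Finset.univ.erase i) =>
    hWG i j (Finset.ne_of_mem_erase hj).symm
  rw [← Finset.mul_sum, N.sum_wMarginals, N.sum_ghzMarginals] at hcount
  have hcount' : ((Finset.univ.filter fun v => ∃ a, N.w v a = i).card : ℝ) ≤
      5 * (Finset.univ.filter fun g =>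
        Function.Injective (N.ghz g) ∧ ∃ a, N.ghz g a = i).card := by
    exact_mod_cast (by omega : _ ≤ 5 * _)
  have hw : (∑ v, holds (N.w v) i * (Real.binEntropy (1 / 3) / Real.log 2)) =
      (Finset.univ.filter fun v => ∃ a, N.w v a = i).card *
        (Real.binEntropy (1 / 3) / Real.log 2) := by
    rw [← Finset.sum_mul, Finset.card_filter, Nat.cast_sum]
    congr 1
    refine Finset.sum_congr rfl fun v _ => ?_
    rw [holds, Nat.cast_ite, Nat.cast_one, Nat.cast_zero]
    congr
  -- With `w` W states at `i`, the pairs cost `w` h(1/3) + `w`/5, and `w`/5 is at most the GHZ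
  -- surplus.
  rw [hw, wMarginalBound]
  linarith
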